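/- Let $r,N\ge 1$, let $\mathbb U=\mathbb R^{m_1\times\cdots\times m_r}$ and $\mathbb V=\mathbb R^{n_1\times\cdots\times n_r}$ carry the entrywise (Frobenius) inner product, and let $A_k\in\mathbb R^{n_k\times m_k}$ for $k=1,\dots,r$. Write $\boldsymbol A=(A_1,\dots,A_r)$, let $\mathsf F_{\boldsymbol A}:\mathbb U\to\mathbb V$ be the Tucker map $$(\mathsf F_{\boldsymbol A}T)_{i_1,\dots,i_r}=\sum_{j_1,\dots,j_r}(A_1)_{i_1j_1}\cdots(A_r)_{i_rj_r}T_{j_1,\dots,j_r},$$ and let $\|\boldsymbol A\|:=\prod_{k=1}^r\|A_k\|$ be the product of the spectral norms. For a linear map $\mathsf M:\mathbb V\to\mathbb V$ let $$\|\mathsf M\|_{\rm ml}:=\max\bigl\{\langle \mathsf M(u_1\otimes\cdots\otimes u_r),v_1\otimes\cdots\otimes v_r\rangle:\ u_k,v_k\in\mathbb R^{n_k},\ \|u_k\|\le1,\ \|v_k\|\le 1\bigr\}.$$ Let $\sigma\ge0$, $\nu\in\mathbb U$, $\mu=\mathsf F_{\boldsymbol A}\nu$, and let $X_1,\dots,X_N$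 be independent random tensors in $\mathbb V$, each following the probabilistic tensor PCA (TPCA) model $X=\mu+\mathsf F_{\boldsymbol A}Z+\varepsilon$, where $Z$ is standard Gaussian in $\mathbb U$, $\varepsilon$ is Gaussian in $\mathbb V$ with mean zero and covariance $\sigma^2\mathbb I_{\mathbb V}$, and $Z$ and $\varepsilon$ are independent. Put $$\Sigma=\sigma^2\mathbb I_{\mathbb V}+\mathsf F_{\boldsymbol A}\mathsf F_{\boldsymbol A}^*,\qquad \mathsf S_N=\frac1N\sum_{i=1}^N(X_i-\mu)\otimes(X_i-\mu),$$ where $S\otimes T$ denotes the operator $W\mapsto\langle T,W\rangle S$. Then for all $\delta_1,\delta_2,\delta_3>0$, with probability at least $1-\delta_1-\delta_2-\delta_3$, $$\|\mathsf S_N-\Sigma\|_{\rm ml}\le t_1+t_2+t_3,$$ where (with $\max\{\alpha,\sqrt\alpha\}$ read as $0$ if $\alpha<0$) $$t_1=2\sigma^2\max\{\alpha_1,\sqrt{\alpha_1}\},\qquad \alpha_1=\frac1{0.145\,N}\Bigl(2\log(10r)\sum_{k=1}^r n_k+\log\tfrac1{\delta_1}\Bigr),$$ $$t_2=2\|\boldsymbol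 A\|^2\max\{\alpha_2,\sqrt{\alpha_2}\},\qquad \alpha_2=\frac1{0.145\,N}\Bigl(2\log(10r)\sum_{k=1}^r m_k+\log\tfrac1{\delta_2}\Bigr),$$ $$t_3=4\sigma\|\boldsymbol A\|\max\{\alpha_3,\sqrt{\alpha_3}\},\qquad \alpha_3=\frac3N\Bigl(\log(10r)\sum_{k=1}^r(n_k+m_k)+\log\tfrac1{\delta_3}\Bigr).$$ -/

import Mathlib

open MeasureTheory ProbabilityTheory

noncomputable section

namespace TPCA

/-- The space of real arrays of size `n 0 × ⋯ × n (r - 1)`, with the entrywise inner product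
`⟪S, T⟫ = ∑ i, S i * T i` and the Frobenius norm. -/
abbrev Tensor {r : ℕ} (n : Fin r → ℕ) : Type :=
  EuclideanSpace ℝ ((k : Fin r) → Fin (n k))

variable {r : ℕ} {m n : Fin r → ℕ}

/-- The rank-one tensor `v₁ ⊗ ⋯ ⊗ vᵣ`, with entries `∏ k, (v k) (i k)`. -/
def rankOne (v : (k : Fin r) → EuclideanSpace ℝ (Fin (n k))) : Tensor n :=
  WithLp.toLp 2 fun i => ∏ k, v k (i k)

/-- The set of rank-one tensors `v₁ ⊗ ⋯ ⊗ vᵣ` with `‖v k‖ ≤ 1` for every `k`. -/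
def rankOneBall (n : Fin r → ℕ) : Set (Tensor n) :=
  {T | ∃ v : (k : Fin r) → EuclideanSpace ℝ (Fin (n k)), (∀ k, ‖v k‖ ≤ 1) ∧ T = rankOne v}

/-- The values `⟪F u, v⟫` for `u`, `v` in the two rank-one balls. -/
def mlValues (F : Tensor m →ₗ[ℝ] Tensor n) : Set ℝ :=
  {x | ∃ u ∈ rankOneBall m, ∃ v ∈ rankOneBall n, x = inner ℝ (F u) v}

/-- The multilinear spectral norm `‖F‖_ml`, the maximum of `⟪F u, v⟫` over rank-one tensors
`u`, `v` whose factors have norm at most one. -/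
def mlNorm (F : Tensor m →ₗ[ℝ] Tensor n) : ℝ :=
  sSup (mlValues F)

theorem isCompact_rankOneBall (n : Fin r → ℕ) : IsCompact (rankOneBall n) := by
  have h : rankOneBall n = rankOne '' (Set.univ.pi fun k =>
      Metric.closedBall (0 : EuclideanSpace ℝ (Fin (n k))) 1) := by
    ext T
    simp only [rankOneBall, Set.mem_ofPred_eq, Set.mem_image, Set.mem_pi, Set.mem_univ,
      forall_true_left, mem_closedBall_zero_iff]
    exact ⟨fun ⟨v, hv, h⟩ => ⟨v, hv, h.symm⟩, fun ⟨v, hv, h⟩ => ⟨v, hv, h.symm⟩⟩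
  rw [h]
  refine (isCompact_univ_pi fun k => isCompact_closedBall _ _).image ?_
  unfold rankOne
  fun_prop

/-- The supremum in `mlNorm` is a maximum. -/
theorem isGreatest_mlNorm (F : Tensor m →ₗ[ℝ] Tensor n) : IsGreatest (mlValues F) (mlNorm F) := by
  have h : mlValues F = (fun p : Tensor m × Tensor n => inner ℝ (F p.1) p.2) ''
      (rankOneBall m ×ˢ rankOneBall n) := by
    ext x
    simp only [mlValues, Set.mem_ofPred_eq, Set.mem_image, Set.mem_prod, Prod.exists]
    exact ⟨fun ⟨u, hu, v, hv, h⟩ => ⟨u, v, ⟨hu, hv⟩, h.symm⟩,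
      fun ⟨u, v, ⟨hu, hv⟩, h⟩ => ⟨u, hu, v, hv, h.symm⟩⟩
  have hF : Continuous F := F.continuous_of_finiteDimensional
  have hc : IsCompact (mlValues F) := by
    rw [h]
    exact ((isCompact_rankOneBall m).prod (isCompact_rankOneBall n)).image (by fun_prop)
  refine hc.isGreatest_sSup ⟨_, rankOne 0, ⟨0, by simp, rfl⟩, rankOne 0, ⟨0, by simp, rfl⟩, rfl⟩

/-- The Tucker map `F_A : T ↦ A · T`, with
`(A · T) i = ∑ j, (A 0) (i 0) (j 0) ⋯ (A (r-1)) (i (r-1)) (j (r-1)) * T j`. -/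
def tucker (A : (k : Fin r) → Matrix (Fin (n k)) (Fin (m k)) ℝ) : Tensor m →ₗ[ℝ] Tensor n where
  toFun T := WithLp.toLp 2 fun i => ∑ j : (k : Fin r) → Fin (m k), (∏ k, A k (i k) (j k)) * T j
  map_add' S T := by
    ext i
    simp [mul_add, Finset.sum_add_distrib]
  map_smul' c T := by
    ext i
    simp [Finset.mul_sum, mul_left_comm]

/-- The spectral norm (Euclidean operator norm) of a real matrix. -/
def specNorm {a b : ℕ} (M : Matrix (Fin a) (Fin b) ℝ) : ℝ :=
  ‖(Matrix.toEuclideanLin M).toContinuousLinearMap‖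

/-- `‖A‖ = ∏ k, ‖A k‖`, the product of the spectral norms of the factor matrices. -/
def prodNorm (A : (k : Fin r) → Matrix (Fin (n k)) (Fin (m k)) ℝ) : ℝ :=
  ∏ k, specNorm (A k)

/-- The operator `S ⊗ T`, that is `W ↦ ⟪T, W⟫ S`. -/
def outer (S : Tensor n) (T : Tensor m) : Tensor m →ₗ[ℝ] Tensor n :=
  (innerₗ (Tensor m) T).smulRight S

variable {Ω : Type*} [MeasurableSpace Ω]

/-- The random tensor `X` is Gaussian with mean `μ` and (positive semidefinite) covariance
operator `C`: every `⟪X, T⟫` is normal with mean `⟪μ, T⟫` and variance `⟪C T, T⟫`. -/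
structure IsGaussian (P : Measure Ω) (X : Ω → Tensor n) (μ : Tensor n)
    (C : Tensor n →ₗ[ℝ] Tensor n) : Prop where
  isPositive : C.IsPositive
  hasLaw : ∀ T : Tensor n, HasLaw (fun ω => inner ℝ (X ω) T)
    (gaussianReal (inner ℝ μ T) (inner ℝ (C T) T).toNNReal) P

/-- The random tensor `X` follows the probabilistic tensor PCA model with factor matrices `A`,
mean `A · ν` and noise level `σ`: `X = A · ν + A · Z + ε` with independent `Z ∼ N(0, I)` and
`ε ∼ N(0, σ² I)`. -/
def FollowsModel (P : Measure Ω) (A : (k : Fin r) → Matrix (Fin (n k)) (Fin (m k)) ℝ)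
    (ν : Tensor m) (σ : ℝ) (X : Ω → Tensor n) : Prop :=
  ∃ (Z : Ω → Tensor m) (ε : Ω → Tensor n),
    IsGaussian P Z 0 LinearMap.id ∧
    IsGaussian P ε 0 (σ ^ 2 • LinearMap.id) ∧
    IndepFun Z ε P ∧
    ∀ᵐ ω ∂P, X ω = tucker A ν + tucker A (Z ω) + ε ω

/-- The covariance operator `Σ = σ² I + F_A F_A^*` of the model. -/
def covariance (A : (k : Fin r) → Matrix (Fin (n k)) (Fin (m k)) ℝ) (σ : ℝ) :
    Tensor n →ₗ[ℝ] Tensor n :=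
  σ ^ 2 • LinearMap.id + tucker A ∘ₗ LinearMap.adjoint (tucker A)

/-- The sample covariance `S_N = N⁻¹ ∑ i, (x i - μ) ⊗ (x i - μ)` of the data `x`, with the mean
`μ` known. -/
def sampleCovariance {N : ℕ} (μ : Tensor n) (x : Fin N → Tensor n) : Tensor n →ₗ[ℝ] Tensor n :=
  (N : ℝ)⁻¹ • ∑ i, outer (x i - μ) (x i - μ)

end TPCA

end

/-!
Writing `X i = μ + F_A z i + σ • ξ i` with independent standard Gaussian `z i` and `ξ i`, the error
`S_N - Σ` splits into a noise part `σ ^ 2 • (N⁻¹ ∑ ξ i ⊗ ξ i - 1)`, a signal part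
`F_A (N⁻¹ ∑ z i ⊗ z i - 1) F_A^*` and a cross part, namely `σ • F_A (N⁻¹ ∑ z i ⊗ ξ i)` plus its
adjoint. Since `F_A^*` maps rank-one tensors to rank-one tensors, composing with `F_A` on the left
or with `F_A^*` on the right multiplies the multilinear norm by at most `‖A‖`.

For each of the three parts, `⟪F u, v⟫` depends on the factors of `u` and `v` in a Lipschitz way
with constant `r ‖F‖_ml`, so the multilinear norm is controlled by its values on a net of tuples of
factors whose mesh is of order `1 / r`; a volume argument bounds the size of the net by
`10 * r` to the power of the total dimension. At a fixed pair of rank-one tensors the value is an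
average of `N` independent products of Gaussian variables. Its moment-generating function is at most
`exp (b t ^ 2)` on a bounded interval of parameters, so Chernoff's inequality gives a tail of order
`exp (-c N α)` at the level `max α √α`, and a union bound over the net concludes.
-/

namespace TPCA

theorem card_le_of_isSeparated {E : Type*} [NormedAddCommGroup E] [NormedSpace ℝ E]
    [FiniteDimensional ℝ E] {ε : NNReal} (hε : 0 < ε) {s : Finset E}
    (hs : (s : Set E) ⊆ Metric.closedBall 0 1) (hsep : Metric.IsSeparated ε (s : Set E)) :
    (s.card : ℝ) ≤ (1 + 2 / ε) ^ Module.finrank ℝ E := by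
  borelize E
  set V : Measure E := Measure.addHaar
  have hε' : (0 : ℝ) < ε := hε
  have hdisj : (s : Set E).PairwiseDisjoint fun x => Metric.ball x ((ε : ℝ) / 2) := by
    intro x hx y hy hxy
    refine Metric.ball_disjoint_ball ?_
    have h : (ε : ℝ) < dist x y := by
      have h : (ε : ENNReal) < edist x y := hsep hx hy hxy
      rwa [edist_nndist, ENNReal.coe_lt_coe, ← NNReal.coe_lt_coe, coe_nndist] at h
    linarith
  have hsub : ⋃ x ∈ s, Metric.ball x ((ε : ℝ) / 2) ⊆ Metric.ball 0 (1 + ε / 2) :=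
    Set.iUnion₂_subset fun x hx => Metric.ball_subset_ball' (by
      linarith [Metric.mem_closedBall.1 (hs hx)])
  have hvol := measure_mono (μ := V) hsub
  rw [measure_biUnion_finset hdisj fun x _ => measurableSet_ball] at hvol
  simp only [V, Measure.addHaar_ball_of_pos _ _ (half_pos hε'),
    Measure.addHaar_ball_of_pos _ _ (show 0 < 1 + (ε : ℝ) / 2 by positivity), Finset.sum_const,
    nsmul_eq_mul, ← mul_assoc] at hvol
  rw [ENNReal.mul_le_mul_iff_left (Metric.measure_ball_pos _ _ one_pos).ne' measure_ball_lt_top.ne,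
    ← ENNReal.ofReal_natCast, ← ENNReal.ofReal_mul (by positivity),
    ENNReal.ofReal_le_ofReal_iff (by positivity)] at hvol
  have hratio : 1 + 2 / (ε : ℝ) = (1 + ε / 2) / (ε / 2) := by field_simp; ring
  rwa [hratio, div_pow, le_div_iff₀ (by positivity)]

theorem packingNumber_closedBall_le (E : Type*) [NormedAddCommGroup E] [NormedSpace ℝ E]
    [FiniteDimensional ℝ E] {ε : NNReal} (hε : 0 < ε) :
    Metric.packingNumber ε (Metric.closedBall (0 : E) 1) ≤
      ⌊(1 + 2 / (ε : ℝ)) ^ Module.finrank ℝ E⌋₊ := by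
  refine iSup₂_le fun C hC => iSup_le fun hsep => ?_
  by_contra! hlt
  obtain ⟨D, hDC, hD⟩ := Set.exists_subset_encard_eq (Order.add_one_le_of_lt hlt)
  have hDfin : D.Finite := Set.finite_of_encard_eq_coe (by exact_mod_cast hD)
  lift D to Finset E using hDfin
  have hcard := Nat.le_floor (card_le_of_isSeparated hε (hDC.trans hC) (hsep.subset hDC))
  rw [Set.encard_coe_eq_coe_finsetCard] at hD
  have hcard' : D.card = ⌊(1 + 2 / (ε : ℝ)) ^ Module.finrank ℝ E⌋₊ + 1 := by exact_mod_cast hD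
  omega

theorem exists_isCover_closedBall (E : Type*) [NormedAddCommGroup E] [NormedSpace ℝ E]
    [FiniteDimensional ℝ E] {ε : NNReal} (hε : 0 < ε) :
    ∃ s : Finset E, (s : Set E) ⊆ Metric.closedBall 0 1 ∧
      Metric.IsCover ε (Metric.closedBall 0 1) (s : Set E) ∧
      (s.card : ℝ) ≤ (1 + 2 / ε) ^ Module.finrank ℝ E := by
  have htop := ((packingNumber_closedBall_le E hε).trans_lt (ENat.natCast_lt_top _)).ne
  have hfin : (Metric.maximalSeparatedSet ε (Metric.closedBall (0 : E) 1)).Finite := by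
    rw [← Set.encard_ne_top_iff, Metric.encard_maximalSeparatedSet htop]
    exact htop
  have hcover := Metric.isCover_maximalSeparatedSet htop
  have hsub := Metric.maximalSeparatedSet_subset (ε := ε) (A := Metric.closedBall (0 : E) 1)
  have hsep := Metric.isSeparated_maximalSeparatedSet (ε := ε) (A := Metric.closedBall (0 : E) 1)
  lift Metric.maximalSeparatedSet ε (Metric.closedBall (0 : E) 1) to Finset E using hfin with s
  exact ⟨s, hsub, hcover, card_le_of_isSeparated hε hsub hsep⟩

theorem norm_image_sub_le_of_mem_closedBall {ι : Type*} [Fintype ι] {E : ι → Type*}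
    [∀ i, NormedAddCommGroup (E i)] [∀ i, NormedSpace ℝ (E i)] {G : Type*}
    [SeminormedAddCommGroup G] [NormedSpace ℝ G] (f : MultilinearMap ℝ E G) {C : ℝ} (hC : 0 ≤ C)
    (hf : ∀ x, ‖f x‖ ≤ C * ∏ i, ‖x i‖) {x y : (i : ι) → E i}
    (hx : x ∈ Metric.closedBall 0 1) (hy : y ∈ Metric.closedBall 0 1) :
    ‖f x - f y‖ ≤ C * Fintype.card ι * ‖x - y‖ := by
  rw [mem_closedBall_zero_iff] at hx hy
  refine (f.norm_image_sub_le_of_bound hC hf x y).trans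
    (mul_le_mul_of_nonneg_right ?_ (norm_nonneg _))
  exact mul_le_of_le_one_right (by positivity)
    (pow_le_one₀ (le_max_of_le_left (norm_nonneg _)) (max_le hx hy))

theorem prod_norm_le_one {ι : Type*} [Fintype ι] {E : ι → Type*}
    [∀ i, SeminormedAddCommGroup (E i)] {v : (i : ι) → E i}
    (hv : v ∈ Metric.closedBall 0 1) : ∏ i, ‖v i‖ ≤ 1 :=
  Finset.prod_le_one (fun _ _ => norm_nonneg _) fun i _ =>
    (norm_le_pi_norm v i).trans (mem_closedBall_zero_iff.1 hv)

/-- The space of tuples `(v₁, …, vᵣ)` of factors of rank-one tensors. It carries the maximum norm,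
so that its closed unit ball is the product of the unit balls of the factors. -/
abbrev Factors {r : ℕ} (n : Fin r → ℕ) : Type :=
  (k : Fin r) → EuclideanSpace ℝ (Fin (n k))

section RankOne

variable {r : ℕ} {m n : Fin r → ℕ}

theorem mem_closedBall_zero_one_iff_forall {v : Factors n} :
    v ∈ Metric.closedBall 0 1 ↔ ∀ k, ‖v k‖ ≤ 1 := by
  rw [mem_closedBall_zero_iff, pi_norm_le_iff_of_nonneg zero_le_one]

/-- The rank-one tensor `v₁ ⊗ ⋯ ⊗ vᵣ` as a multilinear map of its factors. -/
noncomputable def rankOneMultilinear (n : Fin r → ℕ) :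
    MultilinearMap ℝ (fun k => EuclideanSpace ℝ (Fin (n k))) (Tensor n) :=
  (WithLp.linearEquiv 2 ℝ _).symm.toLinearMap.compMultilinearMap <|
    MultilinearMap.pi fun i => (MultilinearMap.mkPiAlgebra ℝ (Fin r) ℝ).compLinearMap
      fun k => EuclideanSpace.projₗ (i k)

@[simp]
theorem rankOneMultilinear_apply (v : Factors n) : rankOneMultilinear n v = rankOne v := rfl

theorem norm_rankOne (v : Factors n) : ‖rankOne v‖ = ∏ k, ‖v k‖ := by
  rw [← sq_eq_sq₀ (norm_nonneg _) (by positivity), ← Finset.prod_pow]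
  simp only [EuclideanSpace.real_norm_sq_eq, Finset.prod_univ_sum, Fintype.piFinset_univ,
    rankOne, Finset.prod_pow]

theorem rankOne_eq_prod_norm_smul (v : Factors n) :
    rankOne v = (∏ k, ‖v k‖) • rankOne fun k => NormedSpace.normalize (v k) := by
  simpa using (rankOneMultilinear n).map_smul_univ (fun k => ‖v k‖)
    fun k => NormedSpace.normalize (v k)

theorem normalize_mem_closedBall (v : Factors n) :
    (fun k => NormedSpace.normalize (v k)) ∈ Metric.closedBall (0 : Factors n) 1 :=
  mem_closedBall_zero_one_iff_forall.2 fun k => by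
    rw [NormedSpace.normalize, norm_smul, norm_inv, norm_norm]
    exact inv_mul_le_one

theorem exists_rankOne_eq_neg (hr : 1 ≤ r) (v : Factors n) :
    ∃ w : Factors n, rankOne w = -rankOne v ∧ ∀ k, ‖w k‖ = ‖v k‖ := by
  refine ⟨Function.update v ⟨0, hr⟩ (-v ⟨0, hr⟩), ?_, fun k => ?_⟩
  · have h := (rankOneMultilinear n).map_update_neg v ⟨0, hr⟩ (v ⟨0, hr⟩)
    rwa [Function.update_eq_self] at h
  · obtain rfl | hk := eq_or_ne k ⟨0, hr⟩
    · rw [Function.update_self, norm_neg]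
    · rw [Function.update_of_ne hk]

theorem inner_map_rankOne_le_mlNorm (F : Tensor m →ₗ[ℝ] Tensor n) {u : Factors m}
    {v : Factors n} (hu : u ∈ Metric.closedBall 0 1) (hv : v ∈ Metric.closedBall 0 1) :
    inner ℝ (F (rankOne u)) (rankOne v) ≤ mlNorm F :=
  (isGreatest_mlNorm F).2 ⟨_, ⟨u, mem_closedBall_zero_one_iff_forall.1 hu, rfl⟩,
    _, ⟨v, mem_closedBall_zero_one_iff_forall.1 hv, rfl⟩, rfl⟩

theorem exists_mlNorm_eq_inner (F : Tensor m →ₗ[ℝ] Tensor n) :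
    ∃ u ∈ Metric.closedBall (0 : Factors m) 1, ∃ v ∈ Metric.closedBall (0 : Factors n) 1,
      mlNorm F = inner ℝ (F (rankOne u)) (rankOne v) := by
  obtain ⟨_, ⟨u, hu, rfl⟩, _, ⟨v, hv, rfl⟩, h⟩ := (isGreatest_mlNorm F).1
  exact ⟨u, mem_closedBall_zero_one_iff_forall.2 hu, v, mem_closedBall_zero_one_iff_forall.2 hv, h⟩

theorem mlNorm_le_iff {F : Tensor m →ₗ[ℝ] Tensor n} {c : ℝ} :
    mlNorm F ≤ c ↔ ∀ u ∈ Metric.closedBall (0 : Factors m) 1,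
      ∀ v ∈ Metric.closedBall (0 : Factors n) 1, inner ℝ (F (rankOne u)) (rankOne v) ≤ c := by
  refine ⟨fun h u hu v hv => (inner_map_rankOne_le_mlNorm F hu hv).trans h, fun h => ?_⟩
  obtain ⟨u, hu, v, hv, hF⟩ := exists_mlNorm_eq_inner F
  exact hF ▸ h u hu v hv

theorem mlNorm_nonneg (hr : 1 ≤ r) (F : Tensor m →ₗ[ℝ] Tensor n) : 0 ≤ mlNorm F := by
  have hzero : rankOne (0 : Factors n) = 0 :=
    (rankOneMultilinear n).map_coord_zero (m := 0) ⟨0, hr⟩ rfl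
  simpa [hzero] using inner_map_rankOne_le_mlNorm F (u := 0) (v := 0) (by simp) (by simp)

theorem inner_map_rankOne_le (F : Tensor m →ₗ[ℝ] Tensor n) (u : Factors m) (v : Factors n) :
    inner ℝ (F (rankOne u)) (rankOne v) ≤ mlNorm F * ((∏ k, ‖u k‖) * ∏ k, ‖v k‖) := by
  rw [rankOne_eq_prod_norm_smul u, rankOne_eq_prod_norm_smul v, map_smul, real_inner_smul_left,
    real_inner_smul_right, ← mul_assoc, mul_comm (mlNorm F)]
  exact mul_le_mul_of_nonneg_left (inner_map_rankOne_le_mlNorm F (normalize_mem_closedBall u)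
    (normalize_mem_closedBall v)) (by positivity)

theorem abs_inner_map_rankOne_le (hr : 1 ≤ r) (F : Tensor m →ₗ[ℝ] Tensor n) (u : Factors m)
    (v : Factors n) :
    |inner ℝ (F (rankOne u)) (rankOne v)| ≤ mlNorm F * ((∏ k, ‖u k‖) * ∏ k, ‖v k‖) := by
  refine abs_le'.2 ⟨inner_map_rankOne_le F u v, ?_⟩
  obtain ⟨w, hw, hnorm⟩ := exists_rankOne_eq_neg hr u
  simpa [hw, hnorm] using inner_map_rankOne_le F w v

theorem abs_inner_map_rankOne_sub_le (hr : 1 ≤ r) (F : Tensor m →ₗ[ℝ] Tensor n)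
    {u u' : Factors m} {v v' : Factors n} (hu : u ∈ Metric.closedBall 0 1)
    (hu' : u' ∈ Metric.closedBall 0 1) (hv : v ∈ Metric.closedBall 0 1)
    (hv' : v' ∈ Metric.closedBall 0 1) :
    |inner ℝ (F (rankOne u)) (rankOne v) - inner ℝ (F (rankOne u')) (rankOne v')| ≤
      mlNorm F * r * (‖u - u'‖ + ‖v - v'‖) := by
  have hF := mlNorm_nonneg hr F
  have hleft := norm_image_sub_le_of_mem_closedBall
    (((innerₗ (Tensor n)).flip (rankOne v) ∘ₗ F).compMultilinearMap (rankOneMultilinear m)) hF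
    (fun x => (abs_inner_map_rankOne_le hr F x v).trans <| mul_le_mul_of_nonneg_left
      (mul_le_of_le_one_right (by positivity) (prod_norm_le_one hv)) hF) hu hu'
  have hright := norm_image_sub_le_of_mem_closedBall
    ((innerₗ (Tensor n) (F (rankOne u'))).compMultilinearMap (rankOneMultilinear n)) hF
    (fun x => (abs_inner_map_rankOne_le hr F u' x).trans <| mul_le_mul_of_nonneg_left
      (mul_le_of_le_one_left (by positivity) (prod_norm_le_one hu')) hF) hv hv'
  rw [Fintype.card_fin] at hleft hright
  calc _ ≤ _ := abs_sub_le _ (inner ℝ (F (rankOne u')) (rankOne v)) _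
    _ ≤ mlNorm F * r * ‖u - u'‖ + mlNorm F * r * ‖v - v'‖ := add_le_add hleft hright
    _ = _ := (mul_add _ _ _).symm

theorem mlNorm_le_of_isCover (hr : 1 ≤ r) (F : Tensor m →ₗ[ℝ] Tensor n) {ε : NNReal} {c : ℝ}
    {s : Set (Factors m × Factors n)} (hs : s ⊆ Metric.closedBall 0 1)
    (hcover : Metric.IsCover ε (Metric.closedBall 0 1) s)
    (hc : ∀ p ∈ s, inner ℝ (F (rankOne p.1)) (rankOne p.2) ≤ c) :
    (1 - 2 * r * ε) * mlNorm F ≤ c := by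
  have mem_prod {p : Factors m × Factors n} : p ∈ Metric.closedBall 0 1 ↔
      p.1 ∈ Metric.closedBall 0 1 ∧ p.2 ∈ Metric.closedBall 0 1 := by
    simp only [mem_closedBall_zero_iff, Prod.norm_def, max_le_iff]
  obtain ⟨u, hu, v, hv, hF⟩ := exists_mlNorm_eq_inner F
  obtain ⟨q, hqs, hq⟩ := Set.mem_iUnion₂.1 (hcover.subset_iUnion_closedBall
    (mem_prod.2 ⟨hu, hv⟩ : (u, v) ∈ Metric.closedBall (0 : Factors m × Factors n) 1))
  obtain ⟨hq₁, hq₂⟩ := mem_prod.1 (hs hqs)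
  have hdist : ‖u - q.1‖ + ‖v - q.2‖ ≤ 2 * ε := by
    rw [mem_closedBall_iff_norm, Prod.norm_def, max_le_iff] at hq
    exact (add_le_add hq.1 hq.2).trans_eq (two_mul _).symm
  have hsub := (le_abs_self _).trans (abs_inner_map_rankOne_sub_le hr F hu hq₁ hv hq₂)
  have hnonneg : 0 ≤ mlNorm F * r := mul_nonneg (mlNorm_nonneg hr F) r.cast_nonneg
  calc (1 - 2 * r * ε) * mlNorm F
      = inner ℝ (F (rankOne u)) (rankOne v) - mlNorm F * r * (2 * ε) := by rw [← hF]; ring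
    _ ≤ inner ℝ (F (rankOne q.1)) (rankOne q.2) := by
        linarith [mul_le_mul_of_nonneg_left hdist hnonneg]
    _ ≤ c := hc q hqs

end RankOne

section MultilinearNorm

variable {r : ℕ} {l m n : Fin r → ℕ}

theorem mlNorm_add_le (F G : Tensor m →ₗ[ℝ] Tensor n) : mlNorm (F + G) ≤ mlNorm F + mlNorm G :=
  mlNorm_le_iff.2 fun u hu v hv => by
    rw [LinearMap.add_apply, inner_add_left]
    exact add_le_add (inner_map_rankOne_le_mlNorm F hu hv) (inner_map_rankOne_le_mlNorm G hu hv)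

theorem mlNorm_smul_le {c : ℝ} (hc : 0 ≤ c) (F : Tensor m →ₗ[ℝ] Tensor n) :
    mlNorm (c • F) ≤ c * mlNorm F :=
  mlNorm_le_iff.2 fun u hu v hv => by
    rw [LinearMap.smul_apply, real_inner_smul_left]
    exact mul_le_mul_of_nonneg_left (inner_map_rankOne_le_mlNorm F hu hv) hc

theorem mlNorm_adjoint (F : Tensor m →ₗ[ℝ] Tensor n) :
    mlNorm (LinearMap.adjoint F) = mlNorm F := by
  have adjoint_le {m n : Fin r → ℕ} (F : Tensor m →ₗ[ℝ] Tensor n) :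
      mlNorm (LinearMap.adjoint F) ≤ mlNorm F :=
    mlNorm_le_iff.2 fun u hu v hv => by
      rw [LinearMap.adjoint_inner_left, real_inner_comm]
      exact inner_map_rankOne_le_mlNorm F hv hu
  exact (adjoint_le F).antisymm (by simpa using adjoint_le (LinearMap.adjoint F))

theorem adjoint_tucker_rankOne (A : (k : Fin r) → Matrix (Fin (n k)) (Fin (m k)) ℝ)
    (v : Factors n) :
    LinearMap.adjoint (tucker A) (rankOne v) =
      rankOne fun k => LinearMap.adjoint (Matrix.toEuclideanLin (A k)) (v k) := by
  have hadj (k : Fin r) : LinearMap.adjoint (Matrix.toEuclideanLin (A k)) (v k) =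
      WithLp.toLp 2 fun j => ∑ i, A k i j * v k i := by
    rw [← Matrix.toEuclideanLin_conjTranspose_eq_adjoint]
    ext j
    simp [Matrix.toLpLin_apply, Matrix.mulVec, dotProduct]
  refine ext_inner_right ℝ fun T => ?_
  rw [LinearMap.adjoint_inner_left]
  simp only [hadj, rankOne, tucker, LinearMap.coe_mk, AddHom.coe_mk, PiLp.inner_apply,
    RCLike.inner_apply, conj_trivial, Finset.prod_univ_sum, Fintype.piFinset_univ,
    Finset.mul_sum, Finset.sum_mul]
  rw [Finset.sum_comm]
  refine Finset.sum_congr rfl fun j _ => Finset.sum_congr rfl fun i _ => ?_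
  rw [Finset.prod_mul_distrib]
  ring

theorem norm_adjoint_toEuclideanLin_le {a b : ℕ} (M : Matrix (Fin a) (Fin b) ℝ)
    (v : EuclideanSpace ℝ (Fin a)) :
    ‖LinearMap.adjoint (Matrix.toEuclideanLin M) v‖ ≤ specNorm M * ‖v‖ := by
  rw [specNorm, ← LinearIsometryEquiv.norm_map ContinuousLinearMap.adjoint,
    ← LinearMap.adjoint_toContinuousLinearMap]
  exact ContinuousLinearMap.le_opNorm _ _

theorem prodNorm_nonneg (A : (k : Fin r) → Matrix (Fin (n k)) (Fin (m k)) ℝ) : 0 ≤ prodNorm A :=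
  Finset.prod_nonneg fun _ _ => norm_nonneg _

theorem prod_norm_adjoint_toEuclideanLin_le
    (A : (k : Fin r) → Matrix (Fin (n k)) (Fin (m k)) ℝ) (v : Factors n) :
    ∏ k, ‖LinearMap.adjoint (Matrix.toEuclideanLin (A k)) (v k)‖ ≤ prodNorm A * ∏ k, ‖v k‖ := by
  rw [prodNorm, ← Finset.prod_mul_distrib]
  exact Finset.prod_le_prod (fun _ _ => norm_nonneg _)
    fun k _ => norm_adjoint_toEuclideanLin_le (A k) (v k)

theorem mlNorm_tucker_comp_le (hr : 1 ≤ r)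
    (A : (k : Fin r) → Matrix (Fin (n k)) (Fin (m k)) ℝ) (F : Tensor l →ₗ[ℝ] Tensor m) :
    mlNorm (tucker A ∘ₗ F) ≤ prodNorm A * mlNorm F :=
  mlNorm_le_iff.2 fun u hu v hv => by
    rw [LinearMap.comp_apply, ← LinearMap.adjoint_inner_right, adjoint_tucker_rankOne,
      mul_comm (prodNorm A)]
    have hv' := (prod_norm_adjoint_toEuclideanLin_le A v).trans
      (mul_le_of_le_one_right (prodNorm_nonneg A) (prod_norm_le_one hv))
    refine (inner_map_rankOne_le F u _).trans (mul_le_mul_of_nonneg_left ?_ (mlNorm_nonneg hr F))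
    exact (mul_le_of_le_one_left (by positivity) (prod_norm_le_one hu)).trans hv'

theorem mlNorm_comp_adjoint_tucker_le (hr : 1 ≤ r)
    (A : (k : Fin r) → Matrix (Fin (n k)) (Fin (m k)) ℝ) (F : Tensor m →ₗ[ℝ] Tensor l) :
    mlNorm (F ∘ₗ LinearMap.adjoint (tucker A)) ≤ prodNorm A * mlNorm F := by
  have h := mlNorm_tucker_comp_le hr A (LinearMap.adjoint F)
  rwa [mlNorm_adjoint, ← mlNorm_adjoint, LinearMap.adjoint_comp, LinearMap.adjoint_adjoint] at h

theorem isClosed_setOf_mlNorm_le {Y : Type*} [TopologicalSpace Y]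
    {F : Y → Tensor m →ₗ[ℝ] Tensor n} (hF : ∀ T, Continuous fun y => F y T) (c : ℝ) :
    IsClosed {y | mlNorm (F y) ≤ c} := by
  simp only [mlNorm_le_iff, Set.ofPred_forall]
  exact isClosed_iInter fun u => isClosed_iInter fun _ => isClosed_iInter fun v =>
    isClosed_iInter fun _ => isClosed_le ((hF _).inner continuous_const) continuous_const

/-- The empirical cross covariance operator `N⁻¹ ∑ i, x i ⊗ y i` of two centred samples. -/
noncomputable def crossCovariance {N : ℕ} (x : Fin N → Tensor n) (y : Fin N → Tensor m) :
    Tensor m →ₗ[ℝ] Tensor n :=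
  (N : ℝ)⁻¹ • ∑ i, outer (x i) (y i)

section CrossCovariance

variable {N : ℕ} (x x' : Fin N → Tensor n) (y y' : Fin N → Tensor m) (σ : ℝ)

theorem crossCovariance_apply (T : Tensor m) :
    crossCovariance x y T = (N : ℝ)⁻¹ • ∑ i, inner ℝ (y i) T • x i := by
  simp [crossCovariance, outer]

theorem inner_crossCovariance (u : Tensor m) (v : Tensor n) :
    inner ℝ (crossCovariance x y u) v = (N : ℝ)⁻¹ * ∑ i, inner ℝ (x i) v * inner ℝ (y i) u := by
  simp only [crossCovariance_apply, real_inner_smul_left, sum_inner, mul_comm]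

theorem inner_crossCovariance_sub_id (hN : 1 ≤ N) (u v : Tensor n) :
    inner ℝ ((crossCovariance x x - LinearMap.id : Tensor n →ₗ[ℝ] Tensor n) u) v =
      (N : ℝ)⁻¹ * ∑ i, (inner ℝ (x i) u * inner ℝ (x i) v - inner ℝ u v) := by
  have : (N : ℝ) ≠ 0 := by positivity
  rw [LinearMap.sub_apply, inner_sub_left, inner_crossCovariance, Finset.sum_sub_distrib,
    Finset.sum_const, Finset.card_univ, Fintype.card_fin, nsmul_eq_mul, mul_sub,
    inv_mul_cancel_left₀ this, LinearMap.id_apply]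
  simp only [mul_comm]

theorem crossCovariance_add_left :
    crossCovariance (x + x') y = crossCovariance x y + crossCovariance x' y := by
  ext1 T
  simp [crossCovariance_apply, Finset.sum_add_distrib]

theorem crossCovariance_add_right :
    crossCovariance x (y + y') = crossCovariance x y + crossCovariance x y' := by
  ext1 T
  simp [crossCovariance_apply, inner_add_left, add_smul, Finset.sum_add_distrib]

theorem crossCovariance_smul_left : crossCovariance (σ • x) y = σ • crossCovariance x y := by
  ext1 T
  simp [crossCovariance_apply, Finset.smul_sum, smul_comm σ]

theorem crossCovariance_smul_right : crossCovariance x (σ • y) = σ • crossCovariance x y := by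
  ext1 T
  simp [crossCovariance_apply, Finset.smul_sum, real_inner_smul_left, smul_comm σ, mul_smul]

theorem crossCovariance_comp_left (F : Tensor n →ₗ[ℝ] Tensor l) :
    crossCovariance (F ∘ x) y = F ∘ₗ crossCovariance x y := by
  ext1 T
  simp [crossCovariance_apply]

theorem adjoint_crossCovariance :
    LinearMap.adjoint (crossCovariance x y) = crossCovariance y x := by
  refine LinearMap.ext fun T => ext_inner_right ℝ fun S => ?_
  rw [LinearMap.adjoint_inner_left, real_inner_comm, inner_crossCovariance,
    inner_crossCovariance]
  simp only [mul_comm]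

theorem crossCovariance_comp_right (F : Tensor m →ₗ[ℝ] Tensor l) :
    crossCovariance x (F ∘ y) = crossCovariance x y ∘ₗ LinearMap.adjoint F := by
  rw [← adjoint_crossCovariance, crossCovariance_comp_left, LinearMap.adjoint_comp,
    adjoint_crossCovariance]

end CrossCovariance

section Decomposition

variable {N : ℕ} (A : (k : Fin r) → Matrix (Fin (n k)) (Fin (m k)) ℝ) (σ : ℝ) (μ : Tensor n)
  (z : Fin N → Tensor m) (ξ : Fin N → Tensor n)

theorem sampleCovariance_eq_crossCovariance (x : Fin N → Tensor n) :
    sampleCovariance μ (fun i => μ + x i) = crossCovariance x x := by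
  simp only [sampleCovariance, crossCovariance, add_sub_cancel_left]

theorem sampleCovariance_sub_covariance_eq :
    sampleCovariance μ (fun i => μ + tucker A (z i) + σ • ξ i) - covariance A σ =
      σ ^ 2 • (crossCovariance ξ ξ - LinearMap.id) +
        tucker A ∘ₗ (crossCovariance z z - LinearMap.id) ∘ₗ LinearMap.adjoint (tucker A) +
        σ • (tucker A ∘ₗ crossCovariance z ξ +
          LinearMap.adjoint (tucker A ∘ₗ crossCovariance z ξ)) := by
  have hsample : sampleCovariance μ (fun i => μ + tucker A (z i) + σ • ξ i) =
      crossCovariance (tucker A ∘ z + σ • ξ) (tucker A ∘ z + σ • ξ) := by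
    rw [← sampleCovariance_eq_crossCovariance μ]
    simp only [Pi.add_apply, Pi.smul_apply, Function.comp_apply, add_assoc]
  rw [hsample, covariance]
  simp only [crossCovariance_add_left, crossCovariance_add_right, crossCovariance_smul_left,
    crossCovariance_smul_right, crossCovariance_comp_left, crossCovariance_comp_right,
    LinearMap.adjoint_comp, adjoint_crossCovariance, LinearMap.comp_sub, LinearMap.sub_comp,
    LinearMap.add_comp, LinearMap.smul_comp, LinearMap.id_comp, LinearMap.comp_assoc]
  module

theorem mlNorm_sampleCovariance_sub_covariance_le (hr : 1 ≤ r) (hσ : 0 ≤ σ) :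
    mlNorm (sampleCovariance μ (fun i => μ + tucker A (z i) + σ • ξ i) - covariance A σ) ≤
      σ ^ 2 * mlNorm (crossCovariance ξ ξ - LinearMap.id) +
      prodNorm A ^ 2 * mlNorm (crossCovariance z z - LinearMap.id) +
      2 * σ * prodNorm A * mlNorm (crossCovariance z ξ) := by
  have hA := prodNorm_nonneg A
  have hnoise := mlNorm_smul_le (sq_nonneg σ) (crossCovariance ξ ξ - LinearMap.id)
  have hsignal := (mlNorm_tucker_comp_le hr A _).trans <| mul_le_mul_of_nonneg_left
    (mlNorm_comp_adjoint_tucker_le hr A (crossCovariance z z - LinearMap.id)) hA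
  have hcross := (mlNorm_smul_le hσ _).trans <| mul_le_mul_of_nonneg_left
    (mlNorm_add_le (tucker A ∘ₗ crossCovariance z ξ)
      (LinearMap.adjoint (tucker A ∘ₗ crossCovariance z ξ))) hσ
  rw [mlNorm_adjoint] at hcross
  have htucker := mul_le_mul_of_nonneg_left (mlNorm_tucker_comp_le hr A (crossCovariance z ξ)) hσ
  rw [sampleCovariance_sub_covariance_eq]
  refine (mlNorm_add_le _ _).trans ?_
  linarith [mlNorm_add_le (σ ^ 2 • (crossCovariance ξ ξ - LinearMap.id))
    (tucker A ∘ₗ (crossCovariance z z - LinearMap.id) ∘ₗ LinearMap.adjoint (tucker A))]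

end Decomposition

end MultilinearNorm

/-- The random variable `X` is subexponential with variance proxy `2 * b` up to the scale `θ`: for
`|t| ≤ θ` its moment-generating function exists and satisfies `E[exp (t * X)] ≤ exp (b * t ^ 2)`.
This is the restriction of `HasSubgaussianMGF X (2 * b)` to a bounded range of parameters. -/
structure HasSubexponentialMGF {Ω : Type*} [MeasurableSpace Ω] (X : Ω → ℝ) (b θ : ℝ)
    (P : Measure Ω) : Prop where
  integrable_exp_mul : ∀ t, |t| ≤ θ → Integrable (fun ω => Real.exp (t * X ω)) P
  mgf_le : ∀ t, |t| ≤ θ → mgf X P t ≤ Real.exp (b * t ^ 2)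

theorem exp_add_le_of_add_le_one {p q x y : ℝ} (hp : 0 ≤ p) (hq : 0 ≤ q) (hpq : p + q ≤ 1) :
    Real.exp (p * x + q * y) ≤ p * Real.exp x + q * Real.exp y + (1 - p - q) := by
  have h := Real.geom_mean_le_arith_mean3_weighted hp hq (by linarith : 0 ≤ 1 - p - q)
    (Real.exp_pos x).le (Real.exp_pos y).le zero_le_one (by ring)
  rw [← Real.exp_mul, ← Real.exp_mul, Real.one_rpow, mul_one, mul_one, ← Real.exp_add] at h
  simpa only [mul_comm] using h

theorem min_one_mul_max_sqrt {α : ℝ} (hα : 0 ≤ α) :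
    min (max α √α) 1 * max α √α = α := by
  obtain h | h := le_total α 1
  · have hsqrt : α ≤ √α := Real.le_sqrt_of_sq_le (by nlinarith)
    rw [max_eq_right hsqrt, min_eq_left (Real.sqrt_le_one.2 h), Real.mul_self_sqrt hα]
  · have hsqrt : √α ≤ α := (Real.sqrt_le_left hα).2 (by nlinarith)
    rw [max_eq_left hsqrt, min_eq_right h, one_mul]

namespace HasSubexponentialMGF

variable {Ω : Type*} [MeasurableSpace Ω] {P : Measure Ω} {X Y : Ω → ℝ} {b θ : ℝ}

theorem aemeasurable (hX : HasSubexponentialMGF X b θ P) (hθ : 0 < θ) : AEMeasurable X P :=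
  Real.aemeasurable_of_aemeasurable_exp_mul hθ.ne'
    (hX.integrable_exp_mul θ (abs_of_pos hθ).le).aemeasurable

theorem comp_hasLaw {S : Type*} [MeasurableSpace S] {κ : Measure S} {f : S → ℝ} {Z : Ω → S}
    (hf : HasSubexponentialMGF f b θ κ) (hθ : 0 < θ) (hZ : HasLaw Z κ P) :
    HasSubexponentialMGF (f ∘ Z) b θ P where
  integrable_exp_mul t ht := by
    have h := hf.integrable_exp_mul t ht
    rw [← hZ.map_eq] at h
    exact h.comp_aemeasurable hZ.aemeasurable
  mgf_le t ht := by
    have h := hf.aemeasurable hθ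
    have hmgf := hf.mgf_le t ht
    rw [← hZ.map_eq] at h hmgf
    rwa [mgf_map hZ.aemeasurable (by fun_prop)] at hmgf

theorem neg (hX : HasSubexponentialMGF X b θ P) : HasSubexponentialMGF (-X) b θ P where
  integrable_exp_mul t ht := by
    simpa using hX.integrable_exp_mul (-t) (by rwa [abs_neg])
  mgf_le t ht := by
    simpa [mgf_neg] using hX.mgf_le (-t) (by rwa [abs_neg])

theorem mul_add_mul [IsProbabilityMeasure P] (hX : HasSubexponentialMGF X b θ P)
    (hY : HasSubexponentialMGF Y b θ P) (hb : 0 ≤ b) (hθ : 0 < θ) {p q : ℝ} (hp : 0 ≤ p)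
    (hq : 0 ≤ q) (hpq : p + q ≤ 1) :
    HasSubexponentialMGF (fun ω => p * X ω + q * Y ω) b θ P := by
  have hXm := hX.aemeasurable hθ
  have hYm := hY.aemeasurable hθ
  have hle (t : ℝ) (ω : Ω) : Real.exp (t * (p * X ω + q * Y ω)) ≤
      p * Real.exp (t * X ω) + q * Real.exp (t * Y ω) + (1 - p - q) := by
    rw [mul_add, mul_left_comm t p, mul_left_comm t q]
    exact exp_add_le_of_add_le_one hp hq hpq
  have hpX {t : ℝ} (ht : |t| ≤ θ) := (hX.integrable_exp_mul t ht).const_mul p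
  have hqY {t : ℝ} (ht : |t| ≤ θ) := (hY.integrable_exp_mul t ht).const_mul q
  have hpXqY {t : ℝ} (ht : |t| ≤ θ) :
      Integrable (fun ω => p * Real.exp (t * X ω) + q * Real.exp (t * Y ω)) P :=
    (hpX ht).add (hqY ht)
  have hbound {t : ℝ} (ht : |t| ≤ θ) := (hpXqY ht).add (integrable_const (1 - p - q))
  have hint {t : ℝ} (ht : |t| ≤ θ) :
      Integrable (fun ω => Real.exp (t * (p * X ω + q * Y ω))) P :=
    (hbound ht).mono' (by fun_prop) (.of_forall fun ω => by
      rw [Real.norm_of_nonneg (Real.exp_pos _).le]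
      exact hle t ω)
  refine ⟨fun t => hint, fun t ht => ?_⟩
  have hone : 1 ≤ Real.exp (b * t ^ 2) := Real.one_le_exp (by positivity)
  calc mgf (fun ω => p * X ω + q * Y ω) P t
      ≤ ∫ ω, p * Real.exp (t * X ω) + q * Real.exp (t * Y ω) + (1 - p - q) ∂P :=
        integral_mono (hint ht) (hbound ht) (hle t)
    _ = p * mgf X P t + q * mgf Y P t + (1 - p - q) := by
        rw [integral_add (hpXqY ht) (integrable_const _),
          integral_add (hpX ht) (hqY ht)]
        simp only [integral_const_mul, integral_const, probReal_univ, one_smul, mgf]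
    _ ≤ p * Real.exp (b * t ^ 2) + q * Real.exp (b * t ^ 2) + (1 - p - q) := by
        gcongr
        exacts [hX.mgf_le t ht, hY.mgf_le t ht]
    _ ≤ Real.exp (b * t ^ 2) := by nlinarith

theorem sum {ι : Type*} [Fintype ι] {X : ι → Ω → ℝ} (hindep : iIndepFun X P)
    (hX : ∀ i, HasSubexponentialMGF (X i) b θ P) (hθ : 0 < θ) :
    HasSubexponentialMGF (∑ i, X i) (Fintype.card ι * b) θ P := by
  have := hindep.isProbabilityMeasure
  have hmgf (t : ℝ) : mgf (∑ i, X i) P t = ∏ i, mgf (X i) P t :=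
    hindep.mgf_sum₀ (fun i => (hX i).aemeasurable hθ) _
  refine ⟨fun t ht => mgf_pos_iff.1 ?_, fun t ht => ?_⟩
  · rw [hmgf]
    exact Finset.prod_pos fun i _ => mgf_pos ((hX i).integrable_exp_mul t ht)
  · calc mgf (∑ i, X i) P t ≤ ∏ _i : ι, Real.exp (b * t ^ 2) :=
          (hmgf t).trans_le (Finset.prod_le_prod (fun _ _ => mgf_nonneg)
            fun i _ => (hX i).mgf_le t ht)
      _ = Real.exp (Fintype.card ι * b * t ^ 2) := by
          rw [Finset.prod_const, Finset.card_univ, ← Real.exp_nat_mul, mul_assoc]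

theorem measureReal_max_sqrt_le_le [IsProbabilityMeasure P] (hX : HasSubexponentialMGF X b θ P)
    (hb : 0 ≤ b) (hθ : 0 ≤ θ) {a c : ℝ} (hc : 0 ≤ c) (hrate : c ≤ a * θ - b * θ ^ 2) (α : ℝ) :
    P.real {ω | a * max α √α ≤ X ω} ≤ Real.exp (-(c * α)) := by
  obtain hα | hα := lt_or_ge α 0
  · exact measureReal_le_one.trans (Real.one_le_exp
      (neg_nonneg.2 (mul_nonpos_of_nonneg_of_nonpos hc hα.le)))
  -- Chernoff's bound is applied with the parameter `θ * min s 1`, because `min s 1 * s = α`.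
  set s := max α √α
  have hmin : 0 ≤ min s 1 := le_min (le_max_of_le_left hα) zero_le_one
  have ht : 0 ≤ θ * min s 1 := mul_nonneg hθ hmin
  have htθ : |θ * min s 1| ≤ θ :=
    (abs_of_nonneg ht).trans_le (mul_le_of_le_one_right hθ (min_le_right _ _))
  have hms : min s 1 * s = α := min_one_mul_max_sqrt hα
  have hmm : min s 1 * min s 1 ≤ α := hms ▸ mul_le_mul_of_nonneg_left (min_le_left _ _) hmin
  calc P.real {ω | a * s ≤ X ω}
      ≤ Real.exp (-(θ * min s 1) * (a * s)) * Real.exp (b * (θ * min s 1) ^ 2) :=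
        (measure_ge_le_exp_mul_mgf _ ht (hX.integrable_exp_mul _ htθ)).trans
          (mul_le_mul_of_nonneg_left (hX.mgf_le _ htθ) (Real.exp_pos _).le)
    _ = Real.exp (-(a * θ * (min s 1 * s)) + b * θ ^ 2 * (min s 1 * min s 1)) := by
        rw [← Real.exp_add]
        ring_nf
    _ ≤ Real.exp (-(c * α)) := Real.exp_le_exp.2 <| by
        rw [hms]
        nlinarith [mul_le_mul_of_nonneg_left hmm (by positivity : 0 ≤ b * θ ^ 2),
          mul_le_mul_of_nonneg_right hrate hα]

end HasSubexponentialMGF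

section Gaussian

theorem mgf_sq_gaussianReal_one {c : ℝ} (hc : 2 * c < 1) :
    mgf (fun x => x ^ 2) (gaussianReal 0 1) c = (√(1 - 2 * c))⁻¹ := by
  have hpos : 0 < 1 - 2 * c := by linarith
  have hdensity (x : ℝ) : gaussianPDFReal 0 1 x • Real.exp (c * x ^ 2) =
      (√(2 * Real.pi))⁻¹ * Real.exp (-((1 - 2 * c) / 2) * x ^ 2) := by
    rw [gaussianPDFReal, smul_eq_mul, mul_assoc, ← Real.exp_add, NNReal.coe_one]
    ring_nf
  rw [mgf, integral_gaussianReal_eq_integral_smul one_ne_zero]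
  simp only [hdensity]
  rw [integral_const_mul, integral_gaussian, ← Real.sqrt_inv, ← Real.sqrt_mul (by positivity),
    ← Real.sqrt_inv]
  congr 1
  field_simp

theorem mgf_sq_gaussianReal {v : NNReal} {c : ℝ} (hc : 2 * (v * c) < 1) :
    mgf (fun x => x ^ 2) (gaussianReal 0 v) c = (√(1 - 2 * (v * c)))⁻¹ := by
  have hscale : (gaussianReal 0 1).map (√v * ·) = gaussianReal 0 v := by
    rw [gaussianReal_map_const_mul, mul_zero, mul_one]
    congr 1
    exact NNReal.eq (Real.sq_sqrt v.coe_nonneg)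
  rw [← hscale, mgf_map (by fun_prop) (by fun_prop), ← mgf_sq_gaussianReal_one hc]
  simp only [mgf, Function.comp_def, mul_pow, Real.sq_sqrt v.coe_nonneg]
  congr! 3
  ring

theorem integrable_exp_mul_sq_gaussianReal {v : NNReal} {c : ℝ} (hc : 2 * (v * c) < 1) :
    Integrable (fun x => Real.exp (c * x ^ 2)) (gaussianReal 0 v) := by
  refine mgf_pos_iff.1 ?_
  rw [mgf_sq_gaussianReal hc]
  have : 0 < 1 - 2 * (v * c) := by linarith
  positivity

theorem inv_sqrt_le_exp_of_neg_le_log {x y : ℝ} (hx : 0 < x) (h : -(2 * y) ≤ Real.log x) :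
    (√x)⁻¹ ≤ Real.exp y := by
  rw [← Real.exp_log (Real.sqrt_pos.2 hx), ← Real.exp_neg, Real.exp_le_exp, Real.log_sqrt hx.le]
  linarith

theorem neg_le_log_one_sub {x : ℝ} (hx : x ≤ 1 / 5) :
    -(2 * x + 10 / 3 * x ^ 2) ≤ Real.log (1 - 2 * x) := by
  have hpos : 0 < 1 - 2 * x := by linarith
  obtain h | h := le_total 0 x
  · rw [Real.le_log_iff_exp_le hpos, Real.exp_neg]
    refine inv_le_of_inv_le₀ hpos (le_trans ?_ (Real.quadratic_le_exp_of_nonneg (by positivity)))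
    rw [inv_le_iff_one_le_mul₀ hpos]
    have hsub := sub_nonneg.2 hx
    nlinarith [sq_nonneg x, mul_nonneg (pow_nonneg h 2) hsub, mul_nonneg (pow_nonneg h 3) hsub,
      mul_nonneg (pow_nonneg h 4) hsub]
  · have hlog := Real.le_log_one_add_of_nonneg (x := -2 * x) (by linarith)
    rw [show 1 + -2 * x = 1 - 2 * x by ring] at hlog
    refine le_trans ?_ hlog
    rw [le_div_iff₀ (by linarith)]
    nlinarith [mul_nonneg (sq_nonneg x) (neg_nonneg.2 h), sq_nonneg x]

theorem neg_le_log_one_sub_of_nonneg {y : ℝ} (hy : 0 ≤ y) (hy' : y ≤ 1 / 4) :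
    -(4 / 3 * y) ≤ Real.log (1 - y) := by
  have hpos : 0 < 1 - y := by linarith
  refine le_trans ?_ (Real.one_sub_inv_le_log_of_pos hpos)
  rw [neg_le_sub_iff_le_add, inv_le_iff_one_le_mul₀ hpos]
  nlinarith

theorem hasSubexponentialMGF_sq_sub_one_gaussianReal :
    HasSubexponentialMGF (fun x => x ^ 2 - 1) (5 / 3) (1 / 5) (gaussianReal 0 1) := by
  have hmgf {t : ℝ} (ht : |t| ≤ 1 / 5) : mgf (fun x => x ^ 2 - 1) (gaussianReal 0 1) t =
      (√(1 - 2 * t))⁻¹ * Real.exp (-t) := by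
    simp only [sub_eq_add_neg, mgf_add_const]
    rw [mgf_sq_gaussianReal_one (by linarith [(abs_le.1 ht).2]), mul_neg_one, sub_eq_add_neg]
  have hpos {t : ℝ} (ht : |t| ≤ 1 / 5) : 0 < 1 - 2 * t := by linarith [(abs_le.1 ht).2]
  refine ⟨fun t ht => mgf_pos_iff.1 ?_, fun t ht => ?_⟩
  · rw [hmgf ht]
    have := hpos ht
    positivity
  · have hlog := neg_le_log_one_sub (abs_le.1 ht).2
    calc _ = _ := hmgf ht
      _ ≤ Real.exp (t + 5 / 3 * t ^ 2) * Real.exp (-t) := by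
          gcongr
          exact inv_sqrt_le_exp_of_neg_le_log (hpos ht) (by linarith)
      _ = Real.exp (5 / 3 * t ^ 2) := by
          rw [← Real.exp_add]
          ring_nf

theorem hasSubexponentialMGF_mul_gaussianReal_prod {v w : NNReal} (hv : v ≤ 1) (hw : w ≤ 1) :
    HasSubexponentialMGF (fun p : ℝ × ℝ => p.1 * p.2) (2 / 3) (1 / 2)
      ((gaussianReal 0 v).prod (gaussianReal 0 w)) := by
  have hinner (t x : ℝ) : ∫ y, Real.exp (t * (x * y)) ∂gaussianReal 0 w =
      Real.exp (w * t ^ 2 / 2 * x ^ 2) := by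
    have h := congrFun (mgf_id_gaussianReal (μ := 0) (v := w)) (t * x)
    simp only [mgf, id_eq, zero_mul, zero_add, mul_assoc] at h
    rw [h]
    ring_nf
  have hinner_int (t x : ℝ) : Integrable (fun y => Real.exp (t * (x * y))) (gaussianReal 0 w) := by
    simpa only [mul_assoc] using integrable_exp_mul_gaussianReal (μ := 0) (v := w) (t * x)
  have hvar_le (t : ℝ) : 2 * (v * (w * t ^ 2 / 2)) ≤ t ^ 2 := by
    have : (v : ℝ) * w ≤ 1 := mul_le_one₀ hv w.coe_nonneg hw
    nlinarith [sq_nonneg t]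
  have hsq_le {t : ℝ} (ht : |t| ≤ 1 / 2) : t ^ 2 ≤ 1 / 4 := by
    rw [← sq_abs]
    nlinarith [abs_nonneg t]
  have hlt {t : ℝ} (ht : |t| ≤ 1 / 2) : 2 * (v * (w * t ^ 2 / 2)) < 1 := by
    linarith [hvar_le t, hsq_le ht]
  have hint {t : ℝ} (ht : |t| ≤ 1 / 2) : Integrable (fun p : ℝ × ℝ => Real.exp (t * (p.1 * p.2)))
      ((gaussianReal 0 v).prod (gaussianReal 0 w)) := by
    rw [integrable_prod_iff (by fun_prop)]
    refine ⟨.of_forall fun x => hinner_int t x, ?_⟩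
    simp only [Real.norm_eq_abs, Real.abs_exp, hinner]
    exact integrable_exp_mul_sq_gaussianReal (hlt ht)
  refine ⟨fun t => hint, fun t ht => ?_⟩
  rw [mgf, integral_prod _ (hint ht)]
  simp only [hinner]
  refine (mgf_sq_gaussianReal (hlt ht)).trans_le (inv_sqrt_le_exp_of_neg_le_log ?_ ?_)
  · linarith [hlt ht]
  · linarith [hvar_le t,
      neg_le_log_one_sub_of_nonneg (by positivity) ((hvar_le t).trans (hsq_le ht))]

end Gaussian

section StdGaussian

variable {E : Type*} [NormedAddCommGroup E] [InnerProductSpace ℝ E] [FiniteDimensional ℝ E]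
  [MeasurableSpace E] [BorelSpace E]

theorem hasLaw_inner_stdGaussian (w : E) :
    HasLaw (fun x => inner ℝ x w) (gaussianReal 0 (‖w‖₊ ^ 2)) (stdGaussian E) where
  aemeasurable := by fun_prop
  map_eq := by
    have h := ProbabilityTheory.IsGaussian.map_eq_gaussianReal (μ := stdGaussian E) (innerSL ℝ w)
    rw [variance_dual_stdGaussian, integral_strongDual_stdGaussian, innerSL_apply_norm] at h
    convert h using 2
    · ext x
      exact real_inner_comm _ _
    · exact NNReal.eq (by simp)

theorem hasSubexponentialMGF_inner_sq_stdGaussian (w : E) :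
    HasSubexponentialMGF (fun x => (inner ℝ x w ^ 2 - ‖w‖ ^ 2) / ‖w‖ ^ 2) (5 / 3) (1 / 5)
      (stdGaussian E) := by
  obtain rfl | hw := eq_or_ne w 0
  · exact ⟨fun t _ => by simp, fun t _ => by simpa [mgf] using by positivity⟩
  have hunit : HasLaw (fun x => inner ℝ x (NormedSpace.normalize w)) (gaussianReal 0 1)
      (stdGaussian E) := by
    have h := hasLaw_inner_stdGaussian (NormedSpace.normalize w)
    rwa [show ‖NormedSpace.normalize w‖₊ = 1 from
      NNReal.eq (NormedSpace.norm_normalize_eq_one_iff.2 hw), one_pow] at h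
  convert hasSubexponentialMGF_sq_sub_one_gaussianReal.comp_hasLaw (by norm_num) hunit using 1
  ext x
  have : ‖w‖ ≠ 0 := norm_ne_zero_iff.2 hw
  simp only [Function.comp_apply, NormedSpace.normalize, real_inner_smul_right]
  field_simp

theorem hasSubexponentialMGF_inner_mul_inner_stdGaussian {u v : E} (hu : ‖u‖ ≤ 1) (hv : ‖v‖ ≤ 1) :
    HasSubexponentialMGF (fun x => inner ℝ x u * inner ℝ x v - inner ℝ u v) (5 / 3) (1 / 5)
      (stdGaussian E) := by
  have hweights : ‖u + v‖ ^ 2 / 4 + ‖u - v‖ ^ 2 / 4 ≤ 1 := by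
    have := parallelogram_law_with_norm ℝ u v
    nlinarith [norm_nonneg u, norm_nonneg v]
  have hcancel (w x : E) :
      ‖w‖ ^ 2 * ((inner ℝ x w ^ 2 - ‖w‖ ^ 2) / ‖w‖ ^ 2) = inner ℝ x w ^ 2 - ‖w‖ ^ 2 := by
    obtain rfl | hw := eq_or_ne w 0
    · simp
    · exact mul_div_cancel₀ _ (by simpa using hw)
  -- Polarization writes the product as a difference of two centred squares.
  convert (hasSubexponentialMGF_inner_sq_stdGaussian (u + v)).mul_add_mul
    (hasSubexponentialMGF_inner_sq_stdGaussian (u - v)).neg (by norm_num) (by norm_num)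
    (by positivity) (by positivity) hweights using 2 with x
  have hadd := hcancel (u + v) x
  have hsub := hcancel (u - v) x
  rw [inner_add_right] at hadd
  rw [inner_sub_right] at hsub
  rw [Pi.neg_apply, inner_add_right, inner_sub_right]
  linear_combination -hadd / 4 + hsub / 4 + norm_add_sq_real u v / 4 - norm_sub_sq_real u v / 4

theorem hasSubexponentialMGF_inner_mul_inner_stdGaussian_prod {F : Type*} [NormedAddCommGroup F]
    [InnerProductSpace ℝ F] [FiniteDimensional ℝ F] [MeasurableSpace F] [BorelSpace F] {u : E}
    {v : F} (hu : ‖u‖ ≤ 1) (hv : ‖v‖ ≤ 1) :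
    HasSubexponentialMGF (fun p : E × F => inner ℝ p.1 u * inner ℝ p.2 v) (2 / 3) (1 / 2)
      ((stdGaussian E).prod (stdGaussian F)) := by
  have hlaw : HasLaw (Prod.map (inner ℝ · u) (inner ℝ · v))
      ((gaussianReal 0 (‖u‖₊ ^ 2)).prod (gaussianReal 0 (‖v‖₊ ^ 2)))
      ((stdGaussian E).prod (stdGaussian F)) := by
    refine ⟨by fun_prop, ?_⟩
    rw [← Measure.map_prod_map _ _ (by fun_prop) (by fun_prop),
      (hasLaw_inner_stdGaussian u).map_eq, (hasLaw_inner_stdGaussian v).map_eq]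
  exact (hasSubexponentialMGF_mul_gaussianReal_prod (pow_le_one₀ zero_le hu)
    (pow_le_one₀ zero_le hv)).comp_hasLaw (by norm_num) hlaw

end StdGaussian

section UnionBound

variable {r : ℕ} {m n : Fin r → ℕ} {Ω : Type*} [MeasurableSpace Ω] {P : Measure Ω}

theorem finrank_factors_prod (m n : Fin r → ℕ) :
    Module.finrank ℝ (Factors m × Factors n) = ∑ k, m k + ∑ k, n k := by
  simp only [Module.finrank_prod, Module.finrank_pi_fintype, finrank_euclideanSpace_fin]

theorem exists_finset_mlNorm_le (hr : 1 ≤ r) (m n : Fin r → ℕ) :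
    ∃ t : Finset (Factors m × Factors n), ↑t ⊆ Metric.closedBall (0 : Factors m × Factors n) 1 ∧
      (t.card : ℝ) ≤ (10 * r) ^ (∑ k, m k + ∑ k, n k) ∧
      ∀ (F : Tensor m →ₗ[ℝ] Tensor n) (c : ℝ),
        (∀ q ∈ t, inner ℝ (F (rankOne q.1)) (rankOne q.2) ≤ c) → mlNorm F ≤ 9 / 5 * c := by
  have hr' : (1 : ℝ) ≤ r := mod_cast hr
  -- The mesh is chosen so that `1 + 2 / ε = 10 * r`.
  obtain ⟨ε, hε⟩ : ∃ ε : NNReal, (ε : ℝ) = 2 / (10 * r - 1) :=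
    ⟨⟨2 / (10 * r - 1), div_nonneg zero_le_two (by linarith)⟩, rfl⟩
  have hεpos : 0 < ε := NNReal.coe_pos.1 (hε ▸ div_pos two_pos (by linarith))
  have hmesh : 5 / 9 ≤ 1 - 2 * r * (ε : ℝ) := by
    rw [hε, mul_div_assoc', le_sub_comm, div_le_iff₀ (by linarith)]
    linarith
  have hbase : 1 + 2 / (ε : ℝ) = 10 * r := by
    rw [hε, div_div_cancel₀ two_ne_zero]
    ring
  obtain ⟨t, ht, hcover, hcard⟩ := exists_isCover_closedBall (Factors m × Factors n) hεpos
  rw [hbase, finrank_factors_prod] at hcard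
  refine ⟨t, ht, hcard, fun F c hF => ?_⟩
  linarith [mlNorm_le_of_isCover hr F ht hcover hF,
    mul_le_mul_of_nonneg_right hmesh (mlNorm_nonneg hr F)]

theorem measureReal_lt_mlNorm_le [IsFiniteMeasure P] (hr : 1 ≤ r)
    (F : Ω → Tensor m →ₗ[ℝ] Tensor n) {s p : ℝ}
    (hF : ∀ u ∈ Metric.closedBall (0 : Factors m) 1, ∀ v ∈ Metric.closedBall (0 : Factors n) 1,
      P.real {ω | s ≤ inner ℝ (F ω (rankOne u)) (rankOne v)} ≤ p) :
    P.real {ω | 9 / 5 * s < mlNorm (F ω)} ≤ (10 * r) ^ (∑ k, m k + ∑ k, n k) * p := by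
  have hp : 0 ≤ p := measureReal_nonneg.trans (hF 0 (by simp) 0 (by simp))
  obtain ⟨t, ht, hcard, hnet⟩ := exists_finset_mlNorm_le hr m n
  have hsubset : {ω | 9 / 5 * s < mlNorm (F ω)} ⊆
      ⋃ q ∈ t, {ω | s ≤ inner ℝ (F ω (rankOne q.1)) (rankOne q.2)} := by
    intro ω hω
    contrapose! hω
    simp only [Set.mem_iUnion, Set.mem_ofPred_eq, not_exists, not_le] at hω
    exact not_lt.2 (hnet (F ω) s fun q hq => (hω q hq).le)
  have htail (q) (hq : q ∈ t) :
      P.real {ω | s ≤ inner ℝ (F ω (rankOne q.1)) (rankOne q.2)} ≤ p := by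
    have hq' := mem_closedBall_zero_iff.1 (ht hq)
    exact hF _ (mem_closedBall_zero_iff.2 ((norm_fst_le q).trans hq'))
      _ (mem_closedBall_zero_iff.2 ((norm_snd_le q).trans hq'))
  calc P.real {ω | 9 / 5 * s < mlNorm (F ω)}
      ≤ ∑ q ∈ t, P.real {ω | s ≤ inner ℝ (F ω (rankOne q.1)) (rankOne q.2)} :=
        (measureReal_mono hsubset (measure_ne_top _ _)).trans (measureReal_biUnion_finset_le _ _)
    _ ≤ t.card * p := (Finset.sum_le_card_nsmul _ _ _ htail).trans_eq (nsmul_eq_mul _ _)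
    _ ≤ (10 * r) ^ (∑ k, m k + ∑ k, n k) * p := mul_le_mul_of_nonneg_right hcard hp

theorem measureReal_max_sqrt_lt_mlNorm_le [IsProbabilityMeasure P] (hr : 1 ≤ r)
    {F : Ω → Tensor m →ₗ[ℝ] Tensor n} {N b θ : ℝ} (hN : 0 < N) (hb : 0 ≤ b) (hθ : 0 ≤ θ)
    (hF : ∀ u ∈ Metric.closedBall (0 : Factors m) 1, ∀ v ∈ Metric.closedBall (0 : Factors n) 1,
      HasSubexponentialMGF (fun ω => N * inner ℝ (F ω (rankOne u)) (rankOne v)) (N * b) θ P)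
    {c α δ : ℝ} (hc : 0 ≤ c) (hrate : c ≤ 10 / 9 * θ - b * θ ^ 2) (hδ : 0 < δ)
    (hα : N * c * α =
      Real.log (10 * r) * (∑ k, (m k : ℝ) + ∑ k, (n k : ℝ)) + Real.log (1 / δ)) :
    P.real {ω | 2 * max α √α < mlNorm (F ω)} ≤ δ := by
  -- The net loses a factor `9 / 5`, so the pointwise tails are taken at `10 / 9`.
  have htail (u) (hu : u ∈ Metric.closedBall (0 : Factors m) 1)
      (v) (hv : v ∈ Metric.closedBall (0 : Factors n) 1) :
      P.real {ω | 10 / 9 * max α √α ≤ inner ℝ (F ω (rankOne u)) (rankOne v)} ≤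
        Real.exp (-(N * c * α)) := by
    have h := (hF u hu v hv).measureReal_max_sqrt_le_le (mul_nonneg hN.le hb) hθ
      (mul_nonneg hN.le hc) (a := N * (10 / 9)) (by nlinarith) α
    simpa only [mul_assoc, mul_le_mul_iff_right₀ hN] using h
  have hunion := measureReal_lt_mlNorm_le hr F htail
  rw [← mul_assoc, show (9 / 5 * (10 / 9) : ℝ) = 2 by norm_num] at hunion
  have hr' : (0 : ℝ) < 10 * r := by positivity
  have hexp : Real.exp (-(N * c * α)) = ((10 * r : ℝ) ^ (∑ k, m k + ∑ k, n k))⁻¹ * δ := by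
    rw [hα, one_div, Real.log_inv, neg_add, neg_neg, Real.exp_add, Real.exp_log hδ, Real.exp_neg,
      mul_comm (Real.log _), ← Real.exp_log (pow_pos hr' _), Real.log_pow]
    push_cast
    rfl
  rwa [hexp, mul_inv_cancel_left₀ (pow_pos hr' _).ne'] at hunion

end UnionBound

section GaussianSamples

variable {r N : ℕ} {m n : Fin r → ℕ} {Ω : Type*} [MeasurableSpace Ω] {P : Measure Ω}

theorem norm_rankOne_le_one {v : Factors n} (hv : v ∈ Metric.closedBall 0 1) : ‖rankOne v‖ ≤ 1 :=
  (norm_rankOne v).trans_le (prod_norm_le_one hv)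

theorem measureReal_lt_mlNorm_crossCovariance_sub_id_le (hr : 1 ≤ r) (hN : 1 ≤ N)
    {x : Fin N → Ω → Tensor n} (hindep : iIndepFun x P)
    (hx : ∀ i, HasLaw (x i) (stdGaussian (Tensor n)) P) {δ α : ℝ} (hδ : 0 < δ)
    (hα : α = 1 / (0.145 * N) *
      (2 * Real.log (10 * r) * ∑ k, (n k : ℝ) + Real.log (1 / δ))) :
    P.real {ω | 2 * max α √α <
      mlNorm (crossCovariance (fun i => x i ω) (fun i => x i ω) - LinearMap.id)} ≤ δ := by
  have := hindep.isProbabilityMeasure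
  have hN' : (0 : ℝ) < N := by positivity
  refine measureReal_max_sqrt_lt_mlNorm_le hr hN' (b := 5 / 3) (θ := 1 / 5) (c := 0.145)
    (by norm_num) (by norm_num) (fun u hu v hv => ?_) (by norm_num) (by norm_num) hδ ?_
  · have hsum := HasSubexponentialMGF.sum
      (hindep.comp (fun _ y => inner ℝ y (rankOne u) * inner ℝ y (rankOne v) -
        inner ℝ (rankOne u) (rankOne v)) fun _ => by fun_prop)
      (fun i => (hasSubexponentialMGF_inner_mul_inner_stdGaussian (norm_rankOne_le_one hu)
        (norm_rankOne_le_one hv)).comp_hasLaw (by norm_num) (hx i)) (by norm_num)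
    rw [Fintype.card_fin] at hsum
    convert hsum using 2 with ω
    rw [inner_crossCovariance_sub_id _ hN, mul_inv_cancel_left₀ hN'.ne', Finset.sum_apply]
    rfl
  · rw [hα]
    field_simp
    ring

theorem measureReal_lt_mlNorm_crossCovariance_le (hr : 1 ≤ r) (hN : 1 ≤ N)
    {z : Fin N → Ω → Tensor m} {ξ : Fin N → Ω → Tensor n}
    (hindep : iIndepFun (fun i ω => (z i ω, ξ i ω)) P)
    (hlaw : ∀ i, HasLaw (fun ω => (z i ω, ξ i ω))
      ((stdGaussian (Tensor m)).prod (stdGaussian (Tensor n))) P) {δ α : ℝ} (hδ : 0 < δ)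
    (hα : α = 3 / N *
      (Real.log (10 * r) * ∑ k, ((n k : ℝ) + (m k : ℝ)) + Real.log (1 / δ))) :
    P.real {ω | 2 * max α √α <
      mlNorm (crossCovariance (fun i => z i ω) (fun i => ξ i ω))} ≤ δ := by
  have := hindep.isProbabilityMeasure
  have hN' : (0 : ℝ) < N := by positivity
  refine measureReal_max_sqrt_lt_mlNorm_le hr hN' (b := 2 / 3) (θ := 1 / 2) (c := 1 / 3)
    (by norm_num) (by norm_num) (fun u hu v hv => ?_) (by norm_num) (by norm_num) hδ ?_
  · have hsum := HasSubexponentialMGF.sum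
      (hindep.comp (fun _ p => inner ℝ p.1 (rankOne v) * inner ℝ p.2 (rankOne u))
        fun _ => by fun_prop)
      (fun i => (hasSubexponentialMGF_inner_mul_inner_stdGaussian_prod (norm_rankOne_le_one hv)
        (norm_rankOne_le_one hu)).comp_hasLaw (by norm_num) (hlaw i)) (by norm_num)
    rw [Fintype.card_fin] at hsum
    convert hsum using 2 with ω
    rw [inner_crossCovariance, mul_inv_cancel_left₀ hN'.ne', Finset.sum_apply]
    rfl
  · rw [hα, Finset.sum_add_distrib]
    field_simp

end GaussianSamples

section CramerWold

variable {E : Type*} [NormedAddCommGroup E] [InnerProductSpace ℝ E] [CompleteSpace E]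
  [SecondCountableTopology E] [MeasurableSpace E] [BorelSpace E]
  {Ω Ω' : Type*} [MeasurableSpace Ω] [MeasurableSpace Ω'] {P : Measure Ω} {Q : Measure Ω'}

theorem identDistrib_of_forall_inner [IsFiniteMeasure P] [IsFiniteMeasure Q] {X : Ω → E}
    {Y : Ω' → E} (hX : AEMeasurable X P) (hY : AEMeasurable Y Q)
    (h : ∀ v, IdentDistrib (fun ω => inner ℝ (X ω) v) (fun ω => inner ℝ (Y ω) v) P Q) :
    IdentDistrib X Y P Q := by
  refine ⟨hX, hY, Measure.ext_of_charFun (funext fun v => ?_)⟩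
  rw [charFun_apply, charFun_apply, integral_map hX (by fun_prop), integral_map hY (by fun_prop)]
  exact ((h v).comp (u := fun x : ℝ => Complex.exp (x * Complex.I)) (by fun_prop)).integral_eq

end CramerWold

section Pi

variable {Ω S E : Type*} [MeasurableSpace Ω] [MeasurableSpace S] [MeasurableSpace E]
  {P : Measure Ω} {κ : Measure S} [IsProbabilityMeasure κ]

theorem identDistrib_pi_of_iIndepFun {ι : Type*} [Fintype ι] {X : ι → Ω → E} {f : S → E}
    (hindep : iIndepFun X P) (hX : ∀ i, IdentDistrib (X i) f P κ) :
    IdentDistrib (fun ω i => X i ω) (fun x i => f (x i)) P (Measure.pi fun _ => κ) := by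
  refine IdentDistrib.pi (fun i => ?_) hindep (iIndepFun_pi fun i => (hX i).aemeasurable_snd)
  exact (hX i).trans (((measurePreserving_eval (fun _ => κ) i).hasLaw.identDistrib
    .id).symm.comp_of_aemeasurable (by simpa using (hX i).aemeasurable_snd))

theorem one_sub_measureReal_le_of_compl_subset {s t : Set S} (h : sᶜ ⊆ t) :
    1 - κ.real t ≤ κ.real s := by
  rw [sub_le_iff_le_add, ← probReal_univ (μ := κ), ← Set.union_compl_self s]
  exact (measureReal_union_le _ _).trans (add_le_add_right (measureReal_mono h) _)

end Pi

section Model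

variable {r : ℕ} {m n : Fin r → ℕ} {Ω : Type*} [MeasurableSpace Ω] {P : Measure Ω}

theorem IsGaussian.aemeasurable {X : Ω → Tensor n} {μ : Tensor n} {C : Tensor n →ₗ[ℝ] Tensor n}
    (h : IsGaussian P X μ C) : AEMeasurable X P := by
  have hcoord (i) : AEMeasurable (fun ω => X ω i) P := by
    simpa [EuclideanSpace.inner_single_right] using
      (h.hasLaw (EuclideanSpace.single i 1)).aemeasurable
  exact (WithLp.measurable_toLp 2 _).comp_aemeasurable (aemeasurable_pi_lambda _ hcoord)

theorem IsGaussian.identDistrib_smul {X : Ω → Tensor n} {σ : ℝ}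
    (h : IsGaussian P X 0 (σ ^ 2 • LinearMap.id)) :
    IdentDistrib X (fun x => σ • x) P (stdGaussian (Tensor n)) := by
  have := (h.hasLaw 0).isProbabilityMeasure
  refine identDistrib_of_forall_inner h.aemeasurable (by fun_prop) fun T => ?_
  have hscaled := hasLaw_inner_stdGaussian (σ • T)
  simp only [real_inner_smul_right, ← real_inner_smul_left] at hscaled
  refine (h.hasLaw T).identDistrib ?_
  convert hscaled using 2
  · exact inner_zero_left T
  · refine NNReal.eq ?_
    simp [real_inner_smul_left, norm_smul, mul_pow, mul_nonneg, sq_nonneg]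

theorem FollowsModel.identDistrib {A : (k : Fin r) → Matrix (Fin (n k)) (Fin (m k)) ℝ}
    {ν : Tensor m} {σ : ℝ} {X : Ω → Tensor n} (h : FollowsModel P A ν σ X) :
    IdentDistrib X (fun x => tucker A ν + tucker A x.1 + σ • x.2) P
      ((stdGaussian (Tensor m)).prod (stdGaussian (Tensor n))) := by
  obtain ⟨Z, ε, hZ, hε, hindep, hX⟩ := h
  have := (hZ.hasLaw 0).isProbabilityMeasure
  have hZ' : IsGaussian P Z 0 ((1 : ℝ) ^ 2 • LinearMap.id) := by simpa using hZ
  have hpair : IdentDistrib (fun ω => (Z ω, ε ω)) (fun x => ((1 : ℝ) • x.1, σ • x.2)) P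
      ((stdGaussian (Tensor m)).prod (stdGaussian (Tensor n))) :=
    (hZ'.identDistrib_smul.trans <| (measurePreserving_fst.hasLaw.identDistrib .id).symm.comp
        (measurable_const_smul _)).prodMk
      (hε.identDistrib_smul.trans <| (measurePreserving_snd.hasLaw.identDistrib .id).symm.comp
        (measurable_const_smul _))
      hindep (indepFun_prod (measurable_const_smul _) (measurable_const_smul _))
  have hA : Continuous (tucker A) := (tucker A).continuous_of_finiteDimensional
  have hmodel : Continuous fun x : Tensor m × Tensor n => tucker A ν + tucker A x.1 + x.2 := by
    fun_prop
  have hsum := hpair.comp hmodel.measurable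
  simp only [Function.comp_def, one_smul] at hsum
  have hX' : (fun ω => tucker A ν + tucker A (Z ω) + ε ω) =ᵐ[P] X := Filter.EventuallyEq.symm hX
  exact (IdentDistrib.of_ae_eq hsum.aemeasurable_fst hX').symm.trans hsum

theorem measureReal_mlNorm_sampleCovariance_le_eq {N : ℕ}
    {A : (k : Fin r) → Matrix (Fin (n k)) (Fin (m k)) ℝ} {ν : Tensor m} {σ : ℝ}
    {X : Fin N → Ω → Tensor n} (hX : ∀ i, FollowsModel P A ν σ (X i)) (hindep : iIndepFun X P)
    (μ : Tensor n) (C : Tensor n →ₗ[ℝ] Tensor n) (t : ℝ) :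
    P.real {ω | mlNorm (sampleCovariance μ (fun i => X i ω) - C) ≤ t} =
      (Measure.pi fun _ : Fin N => (stdGaussian (Tensor m)).prod (stdGaussian (Tensor n))).real
        {x | mlNorm (sampleCovariance μ
          (fun i => tucker A ν + tucker A (x i).1 + σ • (x i).2) - C) ≤ t} := by
  have hclosed : IsClosed {x : Fin N → Tensor n | mlNorm (sampleCovariance μ x - C) ≤ t} := by
    refine isClosed_setOf_mlNorm_le (fun T => ?_) t
    simp only [sampleCovariance, outer, LinearMap.sub_apply, LinearMap.smul_apply,
      LinearMap.sum_apply, LinearMap.smulRight_apply, innerₗ_apply_apply]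
    fun_prop
  exact congrArg ENNReal.toReal ((identDistrib_pi_of_iIndepFun hindep
    fun i => (hX i).identDistrib).measure_mem_eq hclosed.measurableSet)

end Model

section Concentration

theorem one_sub_le_measureReal_mlNorm_sampleCovariance_sub_covariance_le
    {r N : ℕ} {m n : Fin r → ℕ} {Ω : Type*} [MeasurableSpace Ω] {P : Measure Ω}
    (hr : 1 ≤ r) (hN : 1 ≤ N) (A : (k : Fin r) → Matrix (Fin (n k)) (Fin (m k)) ℝ)
    (μ : Tensor n) {σ : ℝ} (hσ : 0 ≤ σ) {z : Fin N → Ω → Tensor m} {ξ : Fin N → Ω → Tensor n}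
    (hindep : iIndepFun (fun i ω => (z i ω, ξ i ω)) P)
    (hlaw : ∀ i, HasLaw (fun ω => (z i ω, ξ i ω))
      ((stdGaussian (Tensor m)).prod (stdGaussian (Tensor n))) P)
    {δ₁ δ₂ δ₃ α₁ α₂ α₃ : ℝ} (hδ₁ : 0 < δ₁) (hδ₂ : 0 < δ₂) (hδ₃ : 0 < δ₃)
    (hα₁ : α₁ = 1 / (0.145 * N) *
      (2 * Real.log (10 * r) * ∑ k, (n k : ℝ) + Real.log (1 / δ₁)))
    (hα₂ : α₂ = 1 / (0.145 * N) *
      (2 * Real.log (10 * r) * ∑ k, (m k : ℝ) + Real.log (1 / δ₂)))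
    (hα₃ : α₃ = 3 / N *
      (Real.log (10 * r) * ∑ k, ((n k : ℝ) + (m k : ℝ)) + Real.log (1 / δ₃))) :
    1 - δ₁ - δ₂ - δ₃ ≤ P.real {ω |
      mlNorm (sampleCovariance μ (fun i => μ + tucker A (z i ω) + σ • ξ i ω) - covariance A σ) ≤
        2 * σ ^ 2 * max α₁ √α₁ + 2 * prodNorm A ^ 2 * max α₂ √α₂ +
          4 * σ * prodNorm A * max α₃ √α₃} := by
  have := hindep.isProbabilityMeasure
  let noiseBad := {ω | 2 * max α₁ √α₁ < mlNorm (crossCovariance (ξ · ω) (ξ · ω) - LinearMap.id)}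
  let signalBad := {ω | 2 * max α₂ √α₂ < mlNorm (crossCovariance (z · ω) (z · ω) - LinearMap.id)}
  let crossBad := {ω | 2 * max α₃ √α₃ < mlNorm (crossCovariance (z · ω) (ξ · ω))}
  have hnoise : P.real noiseBad ≤ δ₁ := measureReal_lt_mlNorm_crossCovariance_sub_id_le hr hN
    (hindep.comp (fun _ => Prod.snd) fun _ => measurable_snd)
    (fun i => measurePreserving_snd.comp_hasLaw (hlaw i)) hδ₁ hα₁
  have hsignal : P.real signalBad ≤ δ₂ := measureReal_lt_mlNorm_crossCovariance_sub_id_le hr hN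
    (hindep.comp (fun _ => Prod.fst) fun _ => measurable_fst)
    (fun i => measurePreserving_fst.comp_hasLaw (hlaw i)) hδ₂ hα₂
  have hcross : P.real crossBad ≤ δ₃ :=
    measureReal_lt_mlNorm_crossCovariance_le hr hN hindep hlaw hδ₃ hα₃
  refine le_trans ?_ (one_sub_measureReal_le_of_compl_subset
    (t := noiseBad ∪ signalBad ∪ crossBad) fun ω hω => ?_)
  · linarith [measureReal_union_le (μ := P) (noiseBad ∪ signalBad) crossBad,
      measureReal_union_le (μ := P) noiseBad signalBad]
  contrapose! hω
  simp only [noiseBad, signalBad, crossBad, Set.mem_union, Set.mem_ofPred_eq, not_or,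
    not_lt] at hω
  obtain ⟨⟨hnoise, hsignal⟩, hcross⟩ := hω
  rw [Set.notMem_compl_iff, Set.mem_ofPred_eq]
  have hA := prodNorm_nonneg A
  linarith [mlNorm_sampleCovariance_sub_covariance_le A σ μ (z · ω) (ξ · ω) hr hσ,
    mul_le_mul_of_nonneg_left hnoise (sq_nonneg σ),
    mul_le_mul_of_nonneg_left hsignal (sq_nonneg (prodNorm A)),
    mul_le_mul_of_nonneg_left hcross (by positivity : 0 ≤ 2 * σ * prodNorm A)]

end Concentration

end TPCA

theorem mainTheorem3 {Ω : Type*} [MeasurableSpace Ω] (P : Measure Ω) [IsProbabilityMeasure P]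
    {r N : ℕ} (hr : 1 ≤ r) (hN : 1 ≤ N) (n m : Fin r → ℕ)
    (A : (k : Fin r) → Matrix (Fin (n k)) (Fin (m k)) ℝ)
    (ν : TPCA.Tensor m) (σ : ℝ) (hσ : 0 ≤ σ)
    (X : Fin N → Ω → TPCA.Tensor n)
    (hX : ∀ i, TPCA.FollowsModel P A ν σ (X i))
    (hindep : iIndepFun X P)
    (δ₁ δ₂ δ₃ : ℝ) (hδ₁ : 0 < δ₁) (hδ₂ : 0 < δ₂) (hδ₃ : 0 < δ₃)
    (α₁ α₂ α₃ t₁ t₂ t₃ : ℝ)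
    (hα₁ : α₁ = 1 / (0.145 * N) *
      (2 * Real.log (10 * r) * ∑ k, (n k : ℝ) + Real.log (1 / δ₁)))
    (hα₂ : α₂ = 1 / (0.145 * N) *
      (2 * Real.log (10 * r) * ∑ k, (m k : ℝ) + Real.log (1 / δ₂)))
    (hα₃ : α₃ = 3 / N *
      (Real.log (10 * r) * ∑ k, ((n k : ℝ) + (m k : ℝ)) + Real.log (1 / δ₃)))
    (ht₁ : t₁ = 2 * σ ^ 2 * max α₁ (Real.sqrt α₁))
    (ht₂ : t₂ = 2 * TPCA.prodNorm A ^ 2 * max α₂ (Real.sqrt α₂))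
    (ht₃ : t₃ = 4 * σ * TPCA.prodNorm A * max α₃ (Real.sqrt α₃)) :
    1 - δ₁ - δ₂ - δ₃ ≤
      P.real {ω | TPCA.mlNorm (TPCA.sampleCovariance (TPCA.tucker A ν) (fun i => X i ω) -
        TPCA.covariance A σ) ≤ t₁ + t₂ + t₃} := by
  have hlaw (i : Fin N) := (measurePreserving_eval (fun _ : Fin N =>
    (stdGaussian (TPCA.Tensor m)).prod (stdGaussian (TPCA.Tensor n))) i).hasLaw
  rw [TPCA.measureReal_mlNorm_sampleCovariance_le_eq hX hindep, ht₁, ht₂, ht₃]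
  exact TPCA.one_sub_le_measureReal_mlNorm_sampleCovariance_sub_covariance_le hr hN A
    (TPCA.tucker A ν) hσ (iIndepFun_pi (X := fun _ => id) fun _ => aemeasurable_id) hlaw
    hδ₁ hδ₂ hδ₃ hα₁ hα₂ hα₃
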